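/- Let $\mathbb{H}$ be the Heisenberg group, i.e. $\mathbb{R}^3$ with the group law \[ (x,y,t)\circ(x',y',t') = (x+x',\,y+y',\,t+t'+2(yx'-y'x)), \] equipped with the left-invariant vector fields $X=\partial_x+2y\,\partial_t$ and $Y=\partial_y-2x\,\partial_t$, the Lebesgue measure $\mathcal{L}^3$, and the Carnot–Carathéodory metric $\mathsf{d}_{CC}$. Here $\mathsf{d}_{CC}(p,q)$ is the infimum of all $T\ge 0$ for which there is an absolutely continuous curve $\gamma:[0,T]\to\mathbb{R}^3$ with $\gamma(0)=p$, $\gamma(T)=q$ such that for almost every $s\in[0,T]$ one has $\gamma'(s)=a\,X(\gamma(s))+b\,Y(\gamma(s))$ for some $a,b\in\mathbb{R}$ with $a^2+b^2\le 1$. Write $B_r(p)=\{q:\mathsf{d}_{CC}(p,q)<r\}$, and $o=(0,0,0)$. Let $u:\mathbb{H}\to\mathbb{R}$ be of class $C^3$ (as a function on $\mathbb{R}^3$). Then at every point $p\in\mathbb{H}$ the asymptotic mean value (AMV) Laplacian \[ \Delta_{\mathcal{L}^3}^{\mathsf{d}_{CC}}u(p)=\lim_{r\to0^+}\frac{1}{r^2}\,\frac{1}{\mathcal{L}^3(B_r(p))}\int_{B_r(p)}\bigl(u(q)-u(p)\bigr)\,d\mathcal{L}^3(q)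 \] exists (for all sufficiently small $r>0$ the ball $B_r(p)$ has positive finite measure and $u$ is integrable on it), and \[ \Delta_{\mathcal{L}^3}^{\mathsf{d}_{CC}}u(p)=c\,\Delta_{\mathbb{H}}u(p),\qquad \Delta_{\mathbb{H}}u=X(Xu)+Y(Yu),\qquad c=\frac12\cdot\frac{1}{\mathcal{L}^3(B_1(o))}\int_{B_1(o)}x^2\,d\mathcal{L}^3(x,y,t). \] -/

import Mathlib

open MeasureTheory Filter Topology
open scoped ENNReal NNReal

/-- The open ball of radius `r` about `x` for a distance function `d` on `α`. -/
def distBall {α : Type*} (d : α → α → ℝ≥0∞) (x : α) (r : ℝ) : Set α :=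
  {y | d x y < ENNReal.ofReal r}

/-- The quotient `r⁻² ⨍_{B_r(x)} (u(y) - u(x)) dμ(y)`. -/
noncomputable def amvQuotient {α : Type*} [MeasurableSpace α] (d : α → α → ℝ≥0∞)
    (μ : Measure α) (u : α → ℝ) (x : α) (r : ℝ) : ℝ :=
  (1 / r ^ 2) * ⨍ y in distBall d x r, (u y - u x) ∂μ

/-- The asymptotic mean value Laplacian of `u` at `x`, with respect to the distance `d` and the
measure `μ`, exists and equals `L`: the averages over small balls are meaningful (balls of positive
finite measure, on which `u` is integrable), and the quotients converge to `L` as `r → 0⁺`. -/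
def HasAMVLaplacianAt {α : Type*} [MeasurableSpace α] (d : α → α → ℝ≥0∞)
    (μ : Measure α) (u : α → ℝ) (x : α) (L : ℝ) : Prop :=
  (∀ᶠ r : ℝ in 𝓝[>] 0, 0 < μ (distBall d x r) ∧ μ (distBall d x r) < ∞ ∧
      IntegrableOn u (distBall d x r) μ) ∧
    Tendsto (fun r : ℝ => amvQuotient d μ u x r) (𝓝[>] 0) (𝓝 L)

/-- The underlying manifold `ℝ³` of the Heisenberg group; a point is `(x, y, t)`. It carries the
product topology and Lebesgue measure `volume`. -/
abbrev Heisenberg : Type := ℝ × ℝ × ℝ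

namespace Heisenberg

/-- The group law `(x,y,t) ∘ (x',y',t') = (x + x', y + y', t + t' + 2(yx' - y'x))`. -/
def comp (p q : Heisenberg) : Heisenberg :=
  (p.1 + q.1, p.2.1 + q.2.1, p.2.2 + q.2.2 + 2 * (p.2.1 * q.1 - q.2.1 * p.1))

/-- The vector field `X = ∂/∂x + 2y ∂/∂t`. -/
def X (p : Heisenberg) : Heisenberg := (1, 0, 2 * p.2.1)

/-- The vector field `Y = ∂/∂y - 2x ∂/∂t`. -/
def Y (p : Heisenberg) : Heisenberg := (0, 1, -(2 * p.1))

/-- `X` is the left-invariant vector field of the group law with value `∂/∂x` at the origin. -/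
theorem hasDerivAt_comp_X (p : Heisenberg) :
    HasDerivAt (fun s : ℝ => comp p (s, 0, 0)) (X p) 0 := by
  have h1 : HasDerivAt (fun s : ℝ => p.1 + s) 1 0 := (hasDerivAt_id (0 : ℝ)).const_add p.1
  have h2 : HasDerivAt (fun _ : ℝ => p.2.1 + 0) 0 0 := hasDerivAt_const _ _
  have h3 : HasDerivAt (fun s : ℝ => p.2.2 + 0 + 2 * (p.2.1 * s - 0 * p.1)) (2 * p.2.1) 0 := by
    simpa using ((((hasDerivAt_id (0 : ℝ)).const_mul p.2.1).sub_const (0 * p.1)).const_mul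
      2).const_add (p.2.2 + 0)
  exact h1.prodMk (h2.prodMk h3)

/-- `Y` is the left-invariant vector field of the group law with value `∂/∂y` at the origin. -/
theorem hasDerivAt_comp_Y (p : Heisenberg) :
    HasDerivAt (fun s : ℝ => comp p (0, s, 0)) (Y p) 0 := by
  have h1 : HasDerivAt (fun _ : ℝ => p.1 + 0) 0 0 := hasDerivAt_const _ _
  have h2 : HasDerivAt (fun s : ℝ => p.2.1 + s) 1 0 := (hasDerivAt_id (0 : ℝ)).const_add p.2.1
  have h3 : HasDerivAt (fun s : ℝ => p.2.2 + 0 + 2 * (p.2.1 * 0 - s * p.1)) (-(2 * p.1)) 0 := by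
    simpa using ((((hasDerivAt_id (0 : ℝ)).mul_const p.1).const_sub (p.2.1 * 0)).const_mul
      2).const_add (p.2.2 + 0)
  exact h1.prodMk (h2.prodMk h3)

/-- The action `V f` of a vector field `V` on a function `f`. -/
noncomputable def lieD (V : Heisenberg → Heisenberg) (f : Heisenberg → ℝ) (p : Heisenberg) : ℝ :=
  fderiv ℝ f p (V p)

/-- The Kohn Laplacian `X²u + Y²u`. -/
noncomputable def kohnLaplacian (u : Heisenberg → ℝ) (p : Heisenberg) : ℝ :=
  lieD X (lieD X u) p + lieD Y (lieD Y u) p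

/-- `γ : [0, T] → ℍ` is an (`X`, `Y`)-subunit curve: it is absolutely continuous, and for almost
every time `γ' = a X(γ) + b Y(γ)` with `a² + b² ≤ 1`. -/
def IsSubunit (T : ℝ) (γ : ℝ → Heisenberg) : Prop :=
  AbsolutelyContinuousOnInterval γ 0 T ∧
    ∀ᵐ s ∂(volume.restrict (Set.Icc 0 T)), ∃ a b : ℝ, a ^ 2 + b ^ 2 ≤ 1 ∧
      HasDerivAt γ (a • X (γ s) + b • Y (γ s)) s

/-- The Carnot–Carathéodory distance: the infimum of the times `T ≥ 0` in which a subunit curve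
leads from `p` to `q`. -/
noncomputable def ccDist (p q : Heisenberg) : ℝ≥0∞ :=
  ⨅ (T : ℝ≥0) (γ : ℝ → Heisenberg) (_ : IsSubunit T γ) (_ : γ 0 = p) (_ : γ T = q), (T : ℝ≥0∞)

end Heisenberg

/-! The affine map `q ↦ p ∘ δ_r q`, with `δ_r (x, y, t) = (r x, r y, r² t)`, pulls `B_r(p)` back to
`B_1(o)`, so averages over `B_r(p)` are integrals against one fixed probability measure
(`setAverage_distBall`). The displacement is `r x X(p) + r y Y(p) + r² t ∂_t`. In the second-order
Taylor polynomial of `u` at `p`, the isometric reflections of `B_1(o)` kill every first moment and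
every mixed second moment, and the swap of `x` and `y` equates the moments of `x²` and `y²`. What
survives (`integral_quadratic`) is `r²` times the Hessian traced over `X, Y`, which is the Kohn
Laplacian (`kohnLaplacian_eq`), plus a vertical term of order `r⁴`. The remainder is `o(r²)` because
`B_1(o)` is bounded (`distBall_one_subset`); averages make sense because it is also a neighbourhood
of `o` (`distBall_mem_nhds`). -/

/-! ### Absolutely continuous curves -/

theorem LipschitzWith.comp_absolutelyContinuousOnInterval {X Y : Type*} [PseudoMetricSpace X]
    [PseudoMetricSpace Y] {Φ : X → Y} {K : ℝ≥0} (hΦ : LipschitzWith K Φ) {f : ℝ → X} {a b : ℝ}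
    (hf : AbsolutelyContinuousOnInterval f a b) :
    AbsolutelyContinuousOnInterval (fun s => Φ (f s)) a b := by
  rw [absolutelyContinuousOnInterval_iff] at hf ⊢
  intro ε hε
  -- `K + 1` rather than `K`, since `K` may vanish.
  obtain ⟨δ, hδ, h⟩ := hf (ε / (K + 1)) (by positivity)
  refine ⟨δ, hδ, fun E hE hsum => ?_⟩
  have hlt := (lt_div_iff₀' (by positivity)).1 (h E hE hsum)
  refine lt_of_le_of_lt ?_ hlt
  rw [Finset.mul_sum]
  refine Finset.sum_le_sum fun i _ => (hΦ.dist_le_mul _ _).trans ?_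
  exact mul_le_mul_of_nonneg_right (by linarith) dist_nonneg

theorem AbsolutelyContinuousOnInterval.comp_div {X : Type*} [PseudoMetricSpace X] {f : ℝ → X}
    {T c : ℝ} (hc : 0 < c) (hT : 0 ≤ T) (hf : AbsolutelyContinuousOnInterval f 0 T) :
    AbsolutelyContinuousOnInterval (fun s => f (s / c)) 0 (c * T) := by
  rw [absolutelyContinuousOnInterval_iff] at hf ⊢
  intro ε hε
  obtain ⟨δ, hδ, h⟩ := hf ε hε
  refine ⟨c * δ, by positivity, fun E hE hsum => ?_⟩
  refine h (E.1, fun i => ((E.2 i).1 / c, (E.2 i).2 / c)) ⟨fun i hi => ?_, ?_⟩ ?_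
  · have := hE.1 i hi
    rw [Set.uIcc_of_le (by positivity)] at this ⊢
    simp only [Set.mem_Icc] at this ⊢
    refine ⟨⟨by have := this.1.1; positivity, ?_⟩, ⟨by have := this.2.1; positivity, ?_⟩⟩ <;>
      rw [div_le_iff₀' hc]
    exacts [this.1.2, this.2.2]
  · intro i hi j hj hij
    have := hE.2 hi hj hij
    simp only [Function.onFun, Set.disjoint_left] at this ⊢
    intro s hs hs'
    have key : ∀ a b : ℝ, s ∈ Set.uIoc (a / c) (b / c) → c * s ∈ Set.uIoc a b := by
      intro a b h
      rw [Set.mem_uIoc] at h ⊢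
      rwa [div_lt_iff₀' hc, le_div_iff₀' hc, div_lt_iff₀' hc, le_div_iff₀' hc] at h
    exact this (key _ _ hs) (key _ _ hs')
  · have : ∀ i, dist ((E.2 i).1 / c) ((E.2 i).2 / c) = dist (E.2 i).1 (E.2 i).2 / c := by
      intro i
      rw [Real.dist_eq, Real.dist_eq, ← sub_div, abs_div, abs_of_pos hc]
    simp only [this, ← Finset.sum_div]
    rwa [div_lt_iff₀' hc]

theorem AbsolutelyContinuousOnInterval.abs_sub_le {f : ℝ → ℝ} {a b C : ℝ} (hab : a ≤ b)
    (hf : AbsolutelyContinuousOnInterval f a b)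
    (hC : ∀ᵐ s ∂volume.restrict (Set.Icc a b), ∃ c, |c| ≤ C ∧ HasDerivAt f c s) :
    |f b - f a| ≤ C * (b - a) := by
  rw [← hf.integral_deriv_eq_sub, ← Real.norm_eq_abs, ← abs_of_nonneg (sub_nonneg.2 hab)]
  refine intervalIntegral.norm_integral_le_of_norm_le_const_ae ?_
  rw [ae_restrict_iff' measurableSet_Icc] at hC
  filter_upwards [hC] with s hs hs'
  rw [Set.uIoc_of_le hab] at hs'
  obtain ⟨c, hc, hd⟩ := hs (Set.Ioc_subset_Icc_self hs')
  rwa [hd.deriv]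

/-! ### Affine maps respecting the horizontal fields -/

namespace Heisenberg

/-- If the linear part sends subunit vectors at `q` to `c` times subunit vectors at `Φ q`, the image
of a subunit curve, slowed down by the factor `c`, is again subunit. Translations, dilations and
reflections are all instances. -/
theorem ccDist_map_le {Φ : Heisenberg → Heisenberg} {L : Heisenberg →L[ℝ] Heisenberg}
    {v : Heisenberg} {c : ℝ} (hc : 0 < c) (hΦ : ∀ q, Φ q = v + L q)
    (hL : ∀ (q : Heisenberg) (a b : ℝ), a ^ 2 + b ^ 2 ≤ 1 → ∃ a' b' : ℝ, a' ^ 2 + b' ^ 2 ≤ 1 ∧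
      L (a • X q + b • Y q) = c • (a' • X (Φ q) + b' • Y (Φ q)))
    (p q : Heisenberg) :
    ccDist (Φ p) (Φ q) ≤ ENNReal.ofReal c * ccDist p q := by
  have hc' : ENNReal.ofReal c ≠ 0 := by simpa using hc
  obtain rfl : Φ = fun q => v + L q := funext hΦ
  have hLip : LipschitzWith ‖L‖₊ (fun q => v + L q) := by
    intro x y
    simpa using L.lipschitz x y
  rw [mul_comm, ← ENNReal.div_le_iff_le_mul (.inl hc') (.inl ENNReal.ofReal_ne_top)]
  refine le_iInf fun T => le_iInf fun γ => le_iInf fun hγ => le_iInf fun h0 => le_iInf fun h1 => ?_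
  rw [ENNReal.div_le_iff_le_mul (.inl hc') (.inl ENNReal.ofReal_ne_top), mul_comm]
  set c' : ℝ≥0 := c.toNNReal
  have hcc : (c' : ℝ) = c := Real.coe_toNNReal _ hc.le
  have hprod : ENNReal.ofReal c * (T : ℝ≥0∞) = ((c' * T : ℝ≥0) : ℝ≥0∞) := by
    simp [c', ENNReal.ofReal]
  rw [hprod]
  refine iInf_le_of_le (c' * T) <| iInf_le_of_le (fun s => v + L (γ (s / c))) <|
    iInf_le_of_le ⟨?_, ?_⟩ <| iInf_le_of_le (by simp [h0]) <| iInf_le_of_le ?_ le_rfl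
  · rw [NNReal.coe_mul, hcc]
    exact hLip.comp_absolutelyContinuousOnInterval (hγ.1.comp_div hc T.2)
  · have h := hγ.2
    rw [ae_restrict_iff' measurableSet_Icc] at h ⊢
    -- Null sets of bad times must stay null after the change of time.
    have hq : Measure.QuasiMeasurePreserving (fun s : ℝ => s / c) volume volume := by
      refine ⟨by fun_prop, ?_⟩
      have := Real.map_volume_mul_right (inv_ne_zero hc.ne')
      simp only [div_eq_mul_inv]
      rw [this]
      exact Measure.smul_absolutelyContinuous
    filter_upwards [hq.ae h] with s hs hsT
    rw [NNReal.coe_mul, hcc] at hsT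
    obtain ⟨a, b, hab, hd⟩ := hs ⟨div_nonneg hsT.1 hc.le, (div_le_iff₀' hc).2 hsT.2⟩
    obtain ⟨a', b', hab', he⟩ := hL (γ (s / c)) a b hab
    refine ⟨a', b', hab', ?_⟩
    have h1 : HasDerivAt (fun s : ℝ => s / c) (1 / c) s := (hasDerivAt_id s).div_const c
    have h2 := (L.hasFDerivAt.comp_hasDerivAt s (hd.scomp s h1)).const_add v
    have h3 : L ((1 / c) • (a • X (γ (s / c)) + b • Y (γ (s / c)))) =
        a' • X (v + L (γ (s / c))) + b' • Y (v + L (γ (s / c))) := by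
      rw [ContinuousLinearMap.map_smul, he, smul_smul, one_div, inv_mul_cancel₀ hc.ne', one_smul]
    exact h3 ▸ h2
  · simp only [NNReal.coe_mul, hcc, mul_div_cancel_left₀ _ hc.ne', h1]

end Heisenberg

namespace Heisenberg

/-- The linear part of `q ↦ p ∘ δ_r q`, where `δ_r (x, y, t) = (r x, r y, r² t)`. -/
noncomputable def leftDilate (p : Heisenberg) {r : ℝ} (hr : r ≠ 0) : Heisenberg ≃L[ℝ] Heisenberg :=
  LinearEquiv.toContinuousLinearEquiv
    { toFun := fun q => (r * q.1, r * q.2.1, r ^ 2 * q.2.2 + 2 * r * (p.2.1 * q.1 - p.1 * q.2.1))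
      invFun := fun q =>
        (q.1 / r, q.2.1 / r, (q.2.2 - 2 * (p.2.1 * q.1 - p.1 * q.2.1)) / r ^ 2)
      map_add' := fun q q' => by
        ext <;> simp <;> ring
      map_smul' := fun a q => by
        ext <;> simp <;> ring
      left_inv := fun q => by
        ext <;> simp <;> field_simp
        ring
      right_inv := fun q => by
        ext <;> simp <;> field_simp
        ring }

theorem leftDilate_apply (p : Heisenberg) {r : ℝ} (hr : r ≠ 0) (q : Heisenberg) :
    leftDilate p hr q =
      (r * q.1, r * q.2.1, r ^ 2 * q.2.2 + 2 * r * (p.2.1 * q.1 - p.1 * q.2.1)) := rfl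

theorem ccDist_leftDilate_le (p : Heisenberg) {r : ℝ} (hr : 0 < r) (q q' : Heisenberg) :
    ccDist (p + leftDilate p hr.ne' q) (p + leftDilate p hr.ne' q') ≤
      ENNReal.ofReal r * ccDist q q' := by
  refine ccDist_map_le (Φ := fun q => p + leftDilate p hr.ne' q)
    (L := (leftDilate p hr.ne' : Heisenberg →L[ℝ] Heisenberg)) hr (fun _ => rfl) ?_ q q'
  intro q a b hab
  refine ⟨a, b, hab, ?_⟩
  ext <;> simp [leftDilate_apply, X, Y]
  ring

theorem ccDist_leftDilate_lt_iff (p : Heisenberg) {r : ℝ} (hr : 0 < r) (q : Heisenberg) :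
    ccDist p (p + leftDilate p hr.ne' q) < ENNReal.ofReal r ↔
      ccDist (0, 0, 0) q < ENNReal.ofReal 1 := by
  have hp : p + leftDilate p hr.ne' (0, 0, 0) = p := by
    simp [leftDilate_apply]
  constructor
  · intro h
    -- `p' = δ_{1/r}(p⁻¹)`, so the inverse map has the same form, with scale `1/r`, and the
    -- one-sided estimate applies to it.
    set p' : Heisenberg := (-p.1 / r, -p.2.1 / r, -p.2.2 / r ^ 2) with hp'
    have hinv : ∀ q, p' + leftDilate p' (inv_pos.2 hr).ne' (p + leftDilate p hr.ne' q) = q := by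
      intro q
      ext <;> simp [leftDilate_apply, hp'] <;> field_simp <;> ring
    have h2 := ccDist_leftDilate_le p' (inv_pos.2 hr) p (p + leftDilate p hr.ne' q)
    have h0 := hinv (0, 0, 0)
    rw [hp] at h0
    rw [h0, hinv q] at h2
    refine h2.trans_lt ?_
    have hr' : ENNReal.ofReal 1 = ENNReal.ofReal r⁻¹ * ENNReal.ofReal r := by
      rw [← ENNReal.ofReal_mul (by positivity), inv_mul_cancel₀ hr.ne']
    rw [hr']
    exact ENNReal.mul_lt_mul_right (by simpa using hr) ENNReal.ofReal_ne_top h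
  · intro h
    have h2 := ccDist_leftDilate_le p hr (0, 0, 0) q
    rw [hp] at h2
    refine h2.trans_lt ?_
    exact (ENNReal.mul_lt_mul_right (by simpa using hr) ENNReal.ofReal_ne_top h).trans_eq (by simp)

theorem preimage_distBall (p : Heisenberg) {r : ℝ} (hr : 0 < r) :
    (fun q => p + leftDilate p hr.ne' q) ⁻¹' distBall ccDist p r =
      distBall ccDist (0, 0, 0) 1 :=
  Set.ext fun q => ccDist_leftDilate_lt_iff p hr q

/-! ### Linear symmetries of balls about the origin -/

/-- The reflection `(x, y, t) ↦ (-x, y, -t)`. -/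
noncomputable def reflectX : Heisenberg ≃L[ℝ] Heisenberg :=
  (ContinuousLinearEquiv.neg ℝ).prodCongr
    ((ContinuousLinearEquiv.refl ℝ ℝ).prodCongr (ContinuousLinearEquiv.neg ℝ))

/-- The reflection `(x, y, t) ↦ (x, -y, -t)`. -/
noncomputable def reflectY : Heisenberg ≃L[ℝ] Heisenberg :=
  (ContinuousLinearEquiv.refl ℝ ℝ).prodCongr
    ((ContinuousLinearEquiv.neg ℝ).prodCongr (ContinuousLinearEquiv.neg ℝ))

/-- The reflection `(x, y, t) ↦ (y, x, -t)`. -/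
noncomputable def swapXY : Heisenberg ≃L[ℝ] Heisenberg :=
  LinearEquiv.toContinuousLinearEquiv
    { toFun := fun q => (q.2.1, q.1, -q.2.2)
      invFun := fun q => (q.2.1, q.1, -q.2.2)
      map_add' := fun q q' => by ext <;> simp; ring
      map_smul' := fun a q => by ext <;> simp
      left_inv := fun q => by simp
      right_inv := fun q => by simp }

theorem reflectX_apply (q : Heisenberg) : reflectX q = (-q.1, q.2.1, -q.2.2) := rfl

theorem reflectY_apply (q : Heisenberg) : reflectY q = (q.1, -q.2.1, -q.2.2) := rfl

theorem swapXY_apply (q : Heisenberg) : swapXY q = (q.2.1, q.1, -q.2.2) := rfl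

theorem preimage_distBall_of_involutive {σ : Heisenberg ≃L[ℝ] Heisenberg}
    (hσ : ∀ q, σ (σ q) = q)
    (hH : ∀ (q : Heisenberg) (a b : ℝ), a ^ 2 + b ^ 2 ≤ 1 → ∃ a' b' : ℝ, a' ^ 2 + b' ^ 2 ≤ 1 ∧
      σ (a • X q + b • Y q) = a' • X (σ q) + b' • Y (σ q)) (r : ℝ) :
    σ ⁻¹' distBall ccDist (0, 0, 0) r = distBall ccDist (0, 0, 0) r := by
  have key : ∀ q, ccDist (0, 0, 0) (σ q) ≤ ccDist (0, 0, 0) q := by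
    intro q
    have := ccDist_map_le (Φ := σ) (L := (σ : Heisenberg →L[ℝ] Heisenberg)) (v := 0) one_pos
      (fun _ => by simp) (by simpa using hH) (0, 0, 0) q
    have h0 : σ (0, 0, 0) = (0, 0, 0) := map_zero σ
    simpa [h0] using this
  ext q
  refine ⟨fun h => ?_, fun h => (key q).trans_lt h⟩
  have := (key (σ q)).trans_lt h
  rwa [hσ] at this

theorem preimage_reflectX (r : ℝ) :
    reflectX ⁻¹' distBall ccDist (0, 0, 0) r = distBall ccDist (0, 0, 0) r := by
  refine preimage_distBall_of_involutive (fun q => by simp [reflectX_apply])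
    (fun q a b hab => ⟨-a, b, by linarith, ?_⟩) r
  ext <;> simp [reflectX_apply, X, Y]
  ring

theorem preimage_reflectY (r : ℝ) :
    reflectY ⁻¹' distBall ccDist (0, 0, 0) r = distBall ccDist (0, 0, 0) r := by
  refine preimage_distBall_of_involutive (fun q => by simp [reflectY_apply])
    (fun q a b hab => ⟨a, -b, by linarith, ?_⟩) r
  ext <;> simp [reflectY_apply, X, Y]
  ring

theorem preimage_swapXY (r : ℝ) :
    swapXY ⁻¹' distBall ccDist (0, 0, 0) r = distBall ccDist (0, 0, 0) r := by
  refine preimage_distBall_of_involutive (fun q => by simp [swapXY_apply])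
    (fun q a b hab => ⟨b, a, by linarith, ?_⟩) r
  ext <;> simp [swapXY_apply, X, Y]

/-! ### The unit ball is bounded and is a neighbourhood of the origin -/

theorem IsSubunit.mono {T S : ℝ} {γ : ℝ → Heisenberg} (hγ : IsSubunit T γ) (hS : 0 ≤ S)
    (hST : S ≤ T) : IsSubunit S γ := by
  refine ⟨hγ.1.mono ?_, ae_restrict_of_ae_restrict_of_subset (Set.Icc_subset_Icc_right hST) hγ.2⟩
  rw [Set.uIcc_of_le hS, Set.uIcc_of_le (hS.trans hST)]
  exact Set.Icc_subset_Icc_right hST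

theorem IsSubunit.abs_fst_sub_le {T : ℝ} {γ : ℝ → Heisenberg} (hT : 0 ≤ T)
    (hγ : IsSubunit T γ) : |(γ T).1 - (γ 0).1| ≤ T := by
  have := (LipschitzWith.prod_fst.comp_absolutelyContinuousOnInterval hγ.1).abs_sub_le
    (C := 1) hT ?_
  · simpa using this
  · filter_upwards [hγ.2] with s ⟨a, b, hab, hd⟩
    refine ⟨a, abs_le_one_iff_mul_self_le_one.2 (by nlinarith), ?_⟩
    have : HasDerivAt (fun s => (γ s).1) _ s := hasFDerivAt_fst.comp_hasDerivAt s hd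
    simpa [X, Y] using this

theorem IsSubunit.abs_snd_sub_le {T : ℝ} {γ : ℝ → Heisenberg} (hT : 0 ≤ T)
    (hγ : IsSubunit T γ) : |(γ T).2.1 - (γ 0).2.1| ≤ T := by
  have := ((LipschitzWith.prod_fst.comp
    LipschitzWith.prod_snd).comp_absolutelyContinuousOnInterval hγ.1).abs_sub_le
    (C := 1) hT ?_
  · simpa using this
  · filter_upwards [hγ.2] with s ⟨a, b, hab, hd⟩
    refine ⟨b, abs_le_one_iff_mul_self_le_one.2 (by nlinarith), ?_⟩
    have : HasDerivAt (fun s => (γ s).2.1) _ s :=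
      hasFDerivAt_fst.comp_hasDerivAt s (hasFDerivAt_snd.comp_hasDerivAt s hd)
    simpa [X, Y] using this

/-- The vertical speed is `2(a y - b x)`, and `|x|, |y| ≤ T` along the curve. -/
theorem IsSubunit.abs_vert_le {T : ℝ} {γ : ℝ → Heisenberg} (hT : 0 ≤ T)
    (hγ : IsSubunit T γ) (h0 : γ 0 = (0, 0, 0)) : |(γ T).2.2| ≤ 4 * T * T := by
  have := ((LipschitzWith.prod_snd.comp
    LipschitzWith.prod_snd).comp_absolutelyContinuousOnInterval hγ.1).abs_sub_le
    (C := 4 * T) hT ?_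
  · simpa [h0] using this
  · filter_upwards [hγ.2, ae_restrict_mem measurableSet_Icc] with s ⟨a, b, hab, hd⟩ hs
    have h1 := (hγ.mono hs.1 hs.2).abs_fst_sub_le hs.1
    have h2 := (hγ.mono hs.1 hs.2).abs_snd_sub_le hs.1
    simp only [h0, sub_zero] at h1 h2
    have ha : |a| ≤ 1 := abs_le_one_iff_mul_self_le_one.2 (by nlinarith)
    have hb : |b| ≤ 1 := abs_le_one_iff_mul_self_le_one.2 (by nlinarith)
    refine ⟨a * (2 * (γ s).2.1) + b * (-(2 * (γ s).1)), ?_, ?_⟩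
    · refine (abs_add_le _ _).trans ?_
      simp only [abs_mul, abs_neg, abs_two]
      have e1 := mul_le_mul ha h2 (abs_nonneg _) zero_le_one
      have e2 := mul_le_mul hb h1 (abs_nonneg _) zero_le_one
      have := hs.2
      nlinarith
    · have : HasDerivAt (fun s => (γ s).2.2) _ s :=
        hasFDerivAt_snd.comp_hasDerivAt s (hasFDerivAt_snd.comp_hasDerivAt s hd)
      simpa [X, Y] using this

theorem distBall_one_subset :
    distBall ccDist (0, 0, 0) 1 ⊆ Metric.closedBall (0 : Heisenberg) 4 := by
  intro q hq
  simp only [distBall, Set.mem_ofPred_eq, ccDist, iInf_lt_iff] at hq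
  obtain ⟨T, γ, hγ, h0, h1, hT⟩ := hq
  have hT : (T : ℝ) < 1 := by
    rw [ENNReal.ofReal_one] at hT
    exact_mod_cast hT
  have a1 := hγ.abs_fst_sub_le T.coe_nonneg
  have a2 := hγ.abs_snd_sub_le T.coe_nonneg
  have a3 := hγ.abs_vert_le T.coe_nonneg h0
  rw [h1] at a1 a2 a3
  simp only [h0, sub_zero] at a1 a2
  have hT0 : (0 : ℝ) ≤ T := T.2
  rw [mem_closedBall_zero_iff, Prod.norm_def, Prod.norm_def]
  simp only [Real.norm_eq_abs]
  refine max_le (by linarith) (max_le (by linarith) ?_)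
  nlinarith

theorem hasDerivAt_quintic (c₁ c₂ c₃ c₄ c₅ s : ℝ) :
    HasDerivAt (fun s : ℝ => c₁ * s + c₂ * s ^ 2 + c₃ * s ^ 3 + c₄ * s ^ 4 + c₅ * s ^ 5)
      (c₁ + c₂ * (2 * s) + c₃ * (3 * s ^ 2) + c₄ * (4 * s ^ 3) + c₅ * (5 * s ^ 4)) s := by
  have h1 := (hasDerivAt_id s).const_mul c₁
  have h2 := (hasDerivAt_pow 2 s).const_mul c₂
  have h3 := (hasDerivAt_pow 3 s).const_mul c₃
  have h4 := (hasDerivAt_pow 4 s).const_mul c₄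
  have h5 := (hasDerivAt_pow 5 s).const_mul c₅
  simpa using (((h1.fun_add h2).fun_add h3).fun_add h4).fun_add h5

/-- An explicit curve on `[0, 1]` with controls `x + A(1 - 2s)` and `y + B(1 - 6s + 6s²)`. The added
shifted Legendre polynomials have mean zero, so the horizontal endpoint is `(x, y)`; they change
only the height, which integrates to the stated `t`. -/
theorem ccDist_le_one {x y t A B : ℝ} (hA : |x| + |A| ≤ 1 / 2) (hB : |y| + |B| ≤ 1 / 2)
    (ht : t = 2 * (A * B / 15 - y * A / 3)) :
    ccDist (0, 0, 0) (x, y, t) ≤ 1 := by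
  set γ : ℝ → Heisenberg := fun s =>
    ((x + A) * s + (-A) * s ^ 2 + 0 * s ^ 3 + 0 * s ^ 4 + 0 * s ^ 5,
      (y + B) * s + (-(3 * B)) * s ^ 2 + (2 * B) * s ^ 3 + 0 * s ^ 4 + 0 * s ^ 5,
      0 * s + 0 * s ^ 2 + (2 * (-(y * A) / 3 + x * B + 2 / 3 * (A * B))) * s ^ 3 +
        (-(2 * (x * B + A * B))) * s ^ 4 + (4 / 5 * (A * B)) * s ^ 5) with hγ
  have hle : ccDist (0, 0, 0) (x, y, t) ≤ ((1 : ℝ≥0) : ℝ≥0∞) := by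
    refine iInf_le_of_le 1 <| iInf_le_of_le γ <| iInf_le_of_le ⟨?_, ?_⟩ <|
      iInf_le_of_le (by simp [hγ]) <| iInf_le_of_le ?_ le_rfl
    · have hsm : ContDiff ℝ 1 γ := by fun_prop
      exact hsm.contDiffOn.absolutelyContinuousOnInterval
    · filter_upwards [ae_restrict_mem measurableSet_Icc] with s hs
      rw [NNReal.coe_one] at hs
      refine ⟨x + A * (1 - 2 * s), y + B * (1 - 6 * s + 6 * s ^ 2), ?_, ?_⟩
      · have h1 : |1 - 2 * s| ≤ 1 := abs_le.2 ⟨by linarith [hs.2], by linarith [hs.1]⟩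
        have h2 : |1 - 6 * s + 6 * s ^ 2| ≤ 1 :=
          abs_le.2 ⟨by nlinarith [sq_nonneg (2 * s - 1)], by nlinarith [hs.1, hs.2]⟩
        have h3 : |x + A * (1 - 2 * s)| ≤ 1 / 2 := by
          refine (abs_add_le _ _).trans (le_trans ?_ hA)
          rw [abs_mul]
          gcongr
          exact mul_le_of_le_one_right (abs_nonneg _) h1
        have h4 : |y + B * (1 - 6 * s + 6 * s ^ 2)| ≤ 1 / 2 := by
          refine (abs_add_le _ _).trans (le_trans ?_ hB)
          rw [abs_mul]
          gcongr
          exact mul_le_of_le_one_right (abs_nonneg _) h2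
        have h5 := sq_le_sq' (abs_le.1 h3).1 (abs_le.1 h3).2
        have h6 := sq_le_sq' (abs_le.1 h4).1 (abs_le.1 h4).2
        linarith
      · have := (hasDerivAt_quintic (x + A) (-A) 0 0 0 s).prodMk
          ((hasDerivAt_quintic (y + B) (-(3 * B)) (2 * B) 0 0 s).prodMk
            (hasDerivAt_quintic 0 0 (2 * (-(y * A) / 3 + x * B + 2 / 3 * (A * B)))
              (-(2 * (x * B + A * B))) (4 / 5 * (A * B)) s))
        refine this.congr_deriv ?_
        ext <;> simp [hγ, X, Y] <;> ring
    · rw [ht]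
      ext <;> simp [hγ] <;> ring
  simpa using hle

theorem distBall_mem_nhds : distBall ccDist (0, 0, 0) 1 ∈ 𝓝 (0 : Heisenberg) := by
  have h2 : distBall ccDist (0, 0, 0) 2 ∈ 𝓝 (0 : Heisenberg) := by
    have hc : Continuous fun q : Heisenberg => 30 * q.2.2 + 5 * q.2.1 := by fun_prop
    have hx : Continuous fun q : Heisenberg => q.1 := by fun_prop
    have hy : Continuous fun q : Heisenberg => q.2.1 := by fun_prop
    have e : ∀ {f : Heisenberg → ℝ}, Continuous f → f 0 = 0 →
        ∀ᶠ q in 𝓝 (0 : Heisenberg), |f q| < 1 / 4 := fun hf h0 => by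
      refine (hf.abs.tendsto 0).eventually_lt_const ?_
      simp [h0]
    filter_upwards [e hx rfl, e hy rfl, e hc (by simp)] with q h1 h2 h3
    -- With `A = 1/4` the height equation is linear in `B`, with solution `30 t + 5 y`.
    have := ccDist_le_one (x := q.1) (y := q.2.1) (t := q.2.2) (A := 1 / 4)
      (B := 30 * q.2.2 + 5 * q.2.1) (by rw [abs_of_pos (by norm_num : (0 : ℝ) < 1 / 4)]; linarith)
      (by linarith) (by ring)
    exact this.trans_lt (by simp)
  -- The curves only give distance at most `1`, hence the ball of radius `2`; dilation brings it
  -- back to radius `1`.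
  rw [← preimage_distBall 0 two_pos]
  refine (Continuous.continuousAt (by fun_prop)).preimage_mem_nhds ?_
  simpa only [map_zero, add_zero] using! h2

end Heisenberg

/-! ### Affine changes of variables in averages, and Taylor expansion -/

/-- A linear image of Haar measure is a scalar multiple of it, and the scalar cancels in an average:
no Jacobian is computed. Since the map is a measurable equivalence, `A` need not be measurable. -/
theorem setAverage_comp_add_continuousLinearEquiv {E F : Type*} [NormedAddCommGroup E]
    [NormedSpace ℝ E] [FiniteDimensional ℝ E] [MeasurableSpace E] [BorelSpace E]
    [NormedAddCommGroup F] [NormedSpace ℝ F] (μ : Measure E) [μ.IsAddHaarMeasure]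
    (L : E ≃L[ℝ] E) (v : E) (A : Set E) (f : E → F) :
    ⨍ q in (fun q => v + L q) ⁻¹' A, f (v + L q) ∂μ = ⨍ q in A, f q ∂μ := by
  have : SecondCountableTopology E := secondCountable_of_proper
  let e : E ≃ᵐ E := (L.toHomeomorph.trans (Homeomorph.addLeft v)).toMeasurableEquiv
  have he : ⇑e = fun q => v + L q := rfl
  have hmap : μ.map e = μ.map L := by
    have h1 : (μ.map L).map (fun q => v + q) = μ.map e :=
      Measure.map_map (measurable_const_add v) L.continuous.measurable
    rw [← h1, map_add_left_eq_self]
  obtain ⟨c, hc0, hct, hc⟩ : ∃ c : ℝ≥0∞, c ≠ 0 ∧ c ≠ ∞ ∧ μ.map L = c • μ :=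
    ⟨_, ENNReal.coe_ne_zero.2 (Measure.addHaarScalarFactor_pos_of_isAddHaarMeasure (μ.map L) μ).ne',
      ENNReal.coe_ne_top, Measure.isAddLeftInvariant_eq_smul (μ.map L) μ⟩
  have h2 : (μ.restrict (e ⁻¹' A)).map e = c • μ.restrict A := by
    rw [← e.restrict_map, hmap, hc, Measure.restrict_smul]
  have h3 : ⨍ q, f q ∂((μ.restrict (e ⁻¹' A)).map e) = ⨍ q, f (e q) ∂(μ.restrict (e ⁻¹' A)) := by
    rw [average_eq, average_eq, integral_map_equiv, Measure.real, Measure.real,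
      Measure.map_apply e.measurable MeasurableSet.univ, Set.preimage_univ]
  have h4 : ⨍ q, f q ∂(c • μ.restrict A) = ⨍ q in A, f q ∂μ := by
    rw [average_eq, average_eq, integral_smul_measure, smul_smul, Measure.real, Measure.real,
      Measure.smul_apply, smul_eq_mul, ENNReal.toReal_mul, mul_inv, mul_right_comm,
      inv_mul_cancel₀ (ENNReal.toReal_ne_zero.2 ⟨hc0, hct⟩), one_mul]
  rw [← h4, ← h2, h3]
  rfl

/-- The remainder has derivative `Du(p+k) - Du(p) - D²u(p) k = o(‖k‖)`, where symmetry of `D²u(p)`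
is used; the mean value inequality on the ball of radius `‖k‖` gains the second factor. -/
theorem ContDiff.taylor_two_isLittleO {E : Type*} [NormedAddCommGroup E] [NormedSpace ℝ E]
    {u : E → ℝ} (hu : ContDiff ℝ 2 u) (p : E) :
    (fun k => u (p + k) - u p - fderiv ℝ u p k - 1 / 2 * fderiv ℝ (fderiv ℝ u) p k k)
      =o[𝓝 0] fun k => ‖k‖ ^ 2 := by
  have hd : Differentiable ℝ u := hu.differentiable (by norm_num)
  have hd2 : DifferentiableAt ℝ (fderiv ℝ u) p :=
    ((hu.fderiv_right (m := 1) (by norm_num)).differentiable (by norm_num)) p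
  set B := fderiv ℝ (fderiv ℝ u) p with hB
  have hsymm : ∀ v w, B v w = B w v := fun v w =>
    (hu.contDiffAt.isSymmSndFDerivAt (by simp)).eq v w
  set w : E → ℝ := fun k => u (p + k) - u p - fderiv ℝ u p k - 1 / 2 * B k k with hw
  have hw' : ∀ k, HasFDerivAt w (fderiv ℝ u (p + k) - fderiv ℝ u p - B k) k := by
    intro k
    have h1 : HasFDerivAt (fun k => u (p + k)) (fderiv ℝ u (p + k)) k := by
      have := (hd (p + k)).hasFDerivAt.comp k ((hasFDerivAt_id k).const_add p)
      rwa [ContinuousLinearMap.comp_id] at this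
    have h2 := (B.hasFDerivAt (x := k)).clm_apply (hasFDerivAt_id k)
    have h3 := ((h1.sub_const (u p)).sub (fderiv ℝ u p).hasFDerivAt).sub (h2.const_mul (1 / 2))
    refine h3.congr_fderiv ?_
    ext v
    simp [hsymm v k]
    ring
  have ho := hd2.hasFDerivAt.isLittleO
  rw [Asymptotics.isLittleO_iff] at ho ⊢
  intro ε hε
  have h0 : Tendsto (fun k : E => p + k) (𝓝 0) (𝓝 p) := by
    simpa using (continuous_const_add p).tendsto 0
  obtain ⟨δ, hδ, hb⟩ := Metric.eventually_nhds_iff_ball.1 (h0.eventually (ho hε))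
  filter_upwards [Metric.ball_mem_nhds 0 hδ] with k hk
  have hbound : ∀ z ∈ Metric.closedBall (0 : E) ‖k‖,
      ‖fderiv ℝ u (p + z) - fderiv ℝ u p - B z‖ ≤ ε * ‖k‖ := by
    intro z hz
    rw [mem_closedBall_zero_iff] at hz
    have := hb z (by rw [mem_ball_zero_iff] at hk ⊢; linarith)
    rw [add_sub_cancel_left] at this
    exact this.trans (by gcongr)
  have := (convex_closedBall (0 : E) ‖k‖).norm_image_sub_le_of_norm_hasFDerivWithin_le
    (fun z _ => (hw' z).hasFDerivWithinAt) hbound (Metric.mem_closedBall_self (norm_nonneg k))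
    (mem_closedBall_zero_iff.2 le_rfl)
  have hw0 : w 0 = 0 := by simp [hw]
  rw [hw0, sub_zero, sub_zero] at this
  rw [norm_pow, norm_norm]
  linarith

/-! ### The Kohn Laplacian and the normalized unit ball -/

namespace Heisenberg

/-- The product rule adds `Du(V' V)`, which vanishes: `X` and `Y` are constant along their own flow
lines. -/
theorem lieD_lieD {u : Heisenberg → ℝ} (hu : ContDiff ℝ 2 u) {V : Heisenberg → Heisenberg}
    {V' : Heisenberg →L[ℝ] Heisenberg} {p : Heisenberg} (hV : HasFDerivAt V V' p)
    (h0 : V' (V p) = 0) :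
    lieD V (lieD V u) p = fderiv ℝ (fderiv ℝ u) p (V p) (V p) := by
  have hd2 : DifferentiableAt ℝ (fderiv ℝ u) p :=
    ((hu.fderiv_right (m := 1) (by norm_num)).differentiable (by norm_num)) p
  have := (hd2.hasFDerivAt.clm_apply hV).fderiv
  change fderiv ℝ (fun q => fderiv ℝ u q (V q)) p (V p) = _
  rw [this]
  simp [h0]

theorem kohnLaplacian_eq {u : Heisenberg → ℝ} (hu : ContDiff ℝ 2 u) (p : Heisenberg) :
    kohnLaplacian u p = fderiv ℝ (fderiv ℝ u) p (X p) (X p) +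
      fderiv ℝ (fderiv ℝ u) p (Y p) (Y p) := by
  have hy : HasFDerivAt (fun q : Heisenberg => q.2.1) _ p :=
    ((ContinuousLinearMap.fst ℝ ℝ ℝ).comp (ContinuousLinearMap.snd ℝ ℝ (ℝ × ℝ))).hasFDerivAt
  have hx : HasFDerivAt (fun q : Heisenberg => q.1) _ p :=
    (ContinuousLinearMap.fst ℝ ℝ (ℝ × ℝ)).hasFDerivAt
  have hX : HasFDerivAt X _ p := (hasFDerivAt_const (1 : ℝ) p).prodMk
    ((hasFDerivAt_const (0 : ℝ) p).prodMk (hy.const_mul 2))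
  have hY : HasFDerivAt Y _ p := (hasFDerivAt_const (0 : ℝ) p).prodMk
    ((hasFDerivAt_const (1 : ℝ) p).prodMk (hx.const_mul 2).neg)
  rw [kohnLaplacian, lieD_lieD hu hX (by simp [X]), lieD_lieD hu hY (by simp [Y])]

instance : (volume : Measure Heisenberg).IsAddHaarMeasure :=
  have : (volume : Measure (ℝ × ℝ)).IsAddHaarMeasure := Measure.prod.instIsAddHaarMeasure _ _
  Measure.prod.instIsAddHaarMeasure _ _

/-- Normalized Lebesgue measure on the unit ball about the origin. -/
noncomputable def unitBallMeasure : Measure Heisenberg :=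
  ((volume.restrict (distBall ccDist (0, 0, 0) 1)) Set.univ)⁻¹ •
    volume.restrict (distBall ccDist (0, 0, 0) 1)

theorem distBall_subset_compact (p : Heisenberg) {r : ℝ} (hr : 0 < r) :
    ∃ K, IsCompact K ∧ distBall ccDist p r ⊆ K := by
  refine ⟨(fun q => p + leftDilate p hr.ne' q) '' Metric.closedBall 0 4,
    (isCompact_closedBall _ _).image (by fun_prop), fun q hq => ?_⟩
  have hq' : p + leftDilate p hr.ne' ((leftDilate p hr.ne').symm (q - p)) = q := by simp
  refine ⟨_, distBall_one_subset ((ccDist_leftDilate_lt_iff p hr _).1 ?_), hq'⟩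
  rw [hq']
  exact hq

theorem volume_distBall_lt_top (p : Heisenberg) {r : ℝ} (hr : 0 < r) :
    volume (distBall ccDist p r) < ∞ := by
  obtain ⟨K, hK, hsub⟩ := distBall_subset_compact p hr
  exact (measure_mono hsub).trans_lt hK.measure_lt_top

theorem volume_distBall_pos (p : Heisenberg) {r : ℝ} (hr : 0 < r) :
    0 < volume (distBall ccDist p r) := by
  refine Measure.measure_pos_of_mem_nhds volume (x := p) ?_
  have h := distBall_mem_nhds
  rw [← preimage_distBall p hr] at h
  have hc : Continuous fun q => (leftDilate p hr.ne').symm (q - p) := by fun_prop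
  have h2 := hc.continuousAt (x := p) |>.preimage_mem_nhds (by simpa using h)
  refine mem_of_superset h2 fun q hq => ?_
  simpa using hq

instance : IsProbabilityMeasure unitBallMeasure := by
  refine ⟨?_⟩
  simp only [unitBallMeasure, Measure.restrict_apply_univ, Measure.smul_apply, smul_eq_mul]
  exact ENNReal.inv_mul_cancel (volume_distBall_pos _ one_pos).ne'
    (volume_distBall_lt_top _ one_pos).ne

theorem setAverage_unitBall (f : Heisenberg → ℝ) :
    ⨍ q in distBall ccDist (0, 0, 0) 1, f q ∂volume = ∫ q, f q ∂unitBallMeasure := rfl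

theorem ae_unitBallMeasure : ∀ᵐ q ∂unitBallMeasure, ‖q‖ ≤ 4 := by
  refine Measure.ae_smul_measure ?_ _
  have := ae_restrict_of_ae_restrict_of_subset (μ := volume) distBall_one_subset
    (ae_restrict_mem Metric.isClosed_closedBall.measurableSet)
  filter_upwards [this] with q hq
  simpa using hq

theorem integrable_unitBallMeasure {f : Heisenberg → ℝ} (hf : Continuous f) :
    Integrable f unitBallMeasure := by
  obtain ⟨C, hC⟩ := (isCompact_closedBall (0 : Heisenberg) 4).exists_bound_of_continuousOn
    hf.continuousOn
  refine Integrable.of_bound hf.aestronglyMeasurable C ?_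
  filter_upwards [ae_unitBallMeasure] with q hq
  exact hC q (by simpa using hq)

theorem integral_unitBallMeasure_comp {σ : Heisenberg ≃L[ℝ] Heisenberg}
    (hσ : σ ⁻¹' distBall ccDist (0, 0, 0) 1 = distBall ccDist (0, 0, 0) 1)
    (f : Heisenberg → ℝ) :
    ∫ q, f (σ q) ∂unitBallMeasure = ∫ q, f q ∂unitBallMeasure := by
  have := setAverage_comp_add_continuousLinearEquiv volume σ 0 (distBall ccDist (0, 0, 0) 1) f
  simp only [zero_add] at this
  rw [← setAverage_unitBall, ← setAverage_unitBall, ← this]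
  congr 2
  exact hσ.symm

theorem integral_eq_zero_of_comp_eq_neg {σ : Heisenberg ≃L[ℝ] Heisenberg}
    (hσ : σ ⁻¹' distBall ccDist (0, 0, 0) 1 = distBall ccDist (0, 0, 0) 1)
    {f : Heisenberg → ℝ} (hf : ∀ q, f (σ q) = -f q) :
    ∫ q, f q ∂unitBallMeasure = 0 := by
  have := integral_unitBallMeasure_comp hσ f
  simp only [hf, integral_neg] at this
  linarith

theorem setAverage_distBall (p : Heisenberg) {r : ℝ} (hr : 0 < r) (f : Heisenberg → ℝ) :
    ⨍ q in distBall ccDist p r, f q ∂volume =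
      ∫ q, f (p + leftDilate p hr.ne' q) ∂unitBallMeasure := by
  rw [← setAverage_unitBall, ← setAverage_comp_add_continuousLinearEquiv volume
    (leftDilate p hr.ne') p (distBall ccDist p r) f, preimage_distBall p hr]

theorem leftDilate_eq (p : Heisenberg) {r : ℝ} (hr : r ≠ 0) (q : Heisenberg) :
    leftDilate p hr q = (r * q.1) • X p + (r * q.2.1) • Y p +
      (r ^ 2 * q.2.2) • ((0, 0, 1) : Heisenberg) := by
  ext <;> simp [leftDilate_apply, X, Y]
  ring

/-! ### Moments, remainder and limit -/

/-- Symmetry leaves only the diagonal second moments when a quadratic expansion is averaged. -/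
theorem integral_quadratic (A : Heisenberg →L[ℝ] ℝ) (B : Heisenberg →L[ℝ] Heisenberg →L[ℝ] ℝ)
    (p : Heisenberg) {r : ℝ} (hr : r ≠ 0) :
    ∫ q, (A (leftDilate p hr q) + 1 / 2 * B (leftDilate p hr q) (leftDilate p hr q))
      ∂unitBallMeasure =
    r ^ 2 * (1 / 2 * (∫ q, q.1 ^ 2 ∂unitBallMeasure) * (B (X p) (X p) + B (Y p) (Y p))) +
      r ^ 4 * (1 / 2 * (∫ q, q.2.2 ^ 2 ∂unitBallMeasure) * B (0, 0, 1) (0, 0, 1)) := by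
  set e : Heisenberg := (0, 0, 1)
  set a := X p
  set b := Y p
  -- `reflectX` flips `x, t` and `reflectY` flips `y, t`; each monomial is odd under the chosen one.
  have hx : ∫ q, q.1 ∂unitBallMeasure = 0 :=
    integral_eq_zero_of_comp_eq_neg (preimage_reflectX 1) fun q => by simp [reflectX_apply]
  have hy : ∫ q, q.2.1 ∂unitBallMeasure = 0 :=
    integral_eq_zero_of_comp_eq_neg (preimage_reflectY 1) fun q => by simp [reflectY_apply]
  have ht : ∫ q, q.2.2 ∂unitBallMeasure = 0 :=
    integral_eq_zero_of_comp_eq_neg (preimage_reflectY 1) fun q => by simp [reflectY_apply]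
  have hxy : ∫ q, q.1 * q.2.1 ∂unitBallMeasure = 0 :=
    integral_eq_zero_of_comp_eq_neg (preimage_reflectX 1) fun q => by simp [reflectX_apply]
  have hxt : ∫ q, q.1 * q.2.2 ∂unitBallMeasure = 0 :=
    integral_eq_zero_of_comp_eq_neg (preimage_reflectY 1) fun q => by simp [reflectY_apply]
  have hyt : ∫ q, q.2.1 * q.2.2 ∂unitBallMeasure = 0 :=
    integral_eq_zero_of_comp_eq_neg (preimage_reflectX 1) fun q => by simp [reflectX_apply]
  have hyy : ∫ q, q.2.1 ^ 2 ∂unitBallMeasure = ∫ q, q.1 ^ 2 ∂unitBallMeasure :=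
    integral_unitBallMeasure_comp (preimage_swapXY 1) fun q => q.1 ^ 2
  have hexp : ∀ q, A (leftDilate p hr q) +
      1 / 2 * B (leftDilate p hr q) (leftDilate p hr q) =
      (r * A a) * q.1 + (r * A b) * q.2.1 + (r ^ 2 * A e) * q.2.2 +
      (r ^ 2 / 2 * B a a) * q.1 ^ 2 + (r ^ 2 / 2 * B b b) * q.2.1 ^ 2 +
      (r ^ 4 / 2 * B e e) * q.2.2 ^ 2 + (r ^ 2 / 2 * (B a b + B b a)) * (q.1 * q.2.1) +
      (r ^ 3 / 2 * (B a e + B e a)) * (q.1 * q.2.2) +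
      (r ^ 3 / 2 * (B b e + B e b)) * (q.2.1 * q.2.2) := by
    intro q
    rw [leftDilate_eq]
    simp only [map_add, map_smul, add_apply, smul_apply, smul_eq_mul]
    ring
  simp only [hexp]
  have hI : ∀ {f : Heisenberg → ℝ}, Continuous f → Integrable f unitBallMeasure :=
    integrable_unitBallMeasure
  repeat rw [integral_add (hI (by fun_prop)) (hI (by fun_prop))]
  simp only [integral_const_mul, hx, hy, ht, hxy, hxt, hyt, hyy]
  ring

theorem norm_leftDilate_le (p : Heisenberg) :
    ∃ C > 0, ∀ {r : ℝ} (hr : r ≠ 0), 0 < r → r ≤ 1 → ∀ q : Heisenberg, ‖q‖ ≤ 4 →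
      ‖leftDilate p hr q‖ ≤ C * r := by
  refine ⟨4 * (‖X p‖ + ‖Y p‖ + ‖((0, 0, 1) : Heisenberg)‖) + 1, by positivity, ?_⟩
  intro r hr h0 h1 q hq
  have hx : |q.1| ≤ 4 := (norm_fst_le q).trans hq
  have hy : |q.2.1| ≤ 4 := (norm_fst_le q.2).trans ((norm_snd_le q).trans hq)
  have ht : |q.2.2| ≤ 4 := (norm_snd_le q.2).trans ((norm_snd_le q).trans hq)
  -- For `r ≤ 1` the vertical part is dominated by order `r`.
  have hr2 : r ^ 2 ≤ r := by nlinarith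
  rw [leftDilate_eq]
  refine (norm_add₃_le).trans ?_
  simp only [norm_smul, Real.norm_eq_abs, abs_mul, abs_of_pos h0, abs_of_pos (pow_pos h0 2)]
  have e1 : r * |q.1| * ‖X p‖ ≤ r * 4 * ‖X p‖ := by gcongr
  have e2 : r * |q.2.1| * ‖Y p‖ ≤ r * 4 * ‖Y p‖ := by gcongr
  have e3 : r ^ 2 * |q.2.2| * ‖((0, 0, 1) : Heisenberg)‖ ≤
      r * 4 * ‖((0, 0, 1) : Heisenberg)‖ := by gcongr
  linarith

theorem tendsto_remainder {R : Heisenberg → ℝ} (hR : R =o[𝓝 0] fun k => ‖k‖ ^ 2)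
    (p : Heisenberg) :
    ∀ ε > 0, ∀ᶠ r : ℝ in 𝓝[>] 0, ∀ hr : r ≠ 0,
      |(1 / r ^ 2) * ∫ q, R (leftDilate p hr q) ∂unitBallMeasure| ≤ ε := by
  intro ε hε
  obtain ⟨C, hC, hbd⟩ := norm_leftDilate_le p
  obtain ⟨δ, hδ, hb⟩ := Metric.eventually_nhds_iff_ball.1
    ((Asymptotics.isLittleO_iff.1 hR) (show 0 < ε / C ^ 2 by positivity))
  filter_upwards [self_mem_nhdsWithin, mem_nhdsWithin_of_mem_nhds (Iio_mem_nhds one_pos),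
    mem_nhdsWithin_of_mem_nhds (Iio_mem_nhds (show 0 < δ / C by positivity))] with r h0 h1 h2 hr
  have h0 : 0 < r := h0
  have h2 : C * r < δ := (lt_div_iff₀' hC).1 h2
  have : ‖∫ q, R (leftDilate p hr q) ∂unitBallMeasure‖ ≤ ε * r ^ 2 := by
    have := norm_integral_le_of_norm_le_const (μ := unitBallMeasure)
      (f := fun q => R (leftDilate p hr q)) (C := ε * r ^ 2) ?_
    · simpa using this
    filter_upwards [ae_unitBallMeasure] with q hq
    have hq' := hbd hr h0 (le_of_lt h1) q hq
    refine (hb _ (mem_ball_zero_iff.2 (hq'.trans_lt h2))).trans ?_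
    rw [norm_pow, norm_norm]
    calc ε / C ^ 2 * ‖leftDilate p hr q‖ ^ 2 ≤ ε / C ^ 2 * (C * r) ^ 2 := by gcongr
      _ = ε * r ^ 2 := by field_simp
  rw [abs_mul, abs_of_pos (by positivity), one_div, inv_mul_le_iff₀ (by positivity), mul_comm]
  exact this

theorem tendsto_amvQuotient {u : Heisenberg → ℝ} (hu : ContDiff ℝ 2 u) (p : Heisenberg) :
    Tendsto (fun r : ℝ => amvQuotient ccDist volume u p r) (𝓝[>] 0)
      (𝓝 ((1 / 2) * (∫ q, q.1 ^ 2 ∂unitBallMeasure) * kohnLaplacian u p)) := by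
  set A := fderiv ℝ u p
  set B := fderiv ℝ (fderiv ℝ u) p
  set R : Heisenberg → ℝ := fun k => u (p + k) - u p - A k - 1 / 2 * B k k with hRdef
  have hR : R =o[𝓝 0] fun k => ‖k‖ ^ 2 := hu.taylor_two_isLittleO p
  set m := 1 / 2 * (∫ q, q.1 ^ 2 ∂unitBallMeasure) * kohnLaplacian u p with hm
  set M := 1 / 2 * (∫ q, q.2.2 ^ 2 ∂unitBallMeasure) * B (0, 0, 1) (0, 0, 1) with hM
  have huc := hu.continuous
  -- An exact identity: `m + r² M` is the averaged Taylor polynomial over `r²`, with `M` from the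
  -- vertical moment.
  have key : ∀ r : ℝ, 0 < r → ∀ hr : r ≠ 0, amvQuotient ccDist volume u p r - (m + r ^ 2 * M) =
      (1 / r ^ 2) * ∫ q, R (leftDilate p hr q) ∂unitBallMeasure := by
    intro r h0 hr
    have hsplit : ∀ q, u (p + leftDilate p hr q) - u p = R (leftDilate p hr q) +
        (A (leftDilate p hr q) + 1 / 2 * B (leftDilate p hr q) (leftDilate p hr q)) := by
      intro q
      simp only [hRdef]
      ring
    rw [amvQuotient, setAverage_distBall p h0]
    simp only [hsplit]
    rw [integral_add (integrable_unitBallMeasure (by fun_prop))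
      (integrable_unitBallMeasure (by fun_prop)), integral_quadratic A B p hr,
      ← kohnLaplacian_eq hu, ← hm, ← hM]
    field_simp
    ring
  have hrem : Tendsto (fun r : ℝ => amvQuotient ccDist volume u p r - (m + r ^ 2 * M)) (𝓝[>] 0)
      (𝓝 0) := by
    rw [Metric.tendsto_nhds]
    intro ε hε
    filter_upwards [tendsto_remainder hR p (ε / 2) (by positivity), self_mem_nhdsWithin]
      with r hr h0
    rw [key r h0 (ne_of_gt h0), Real.dist_eq, sub_zero]
    exact (hr _).trans_lt (by linarith)
  have hpoly : Tendsto (fun r : ℝ => m + r ^ 2 * M) (𝓝[>] 0) (𝓝 m) := by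
    have hc : Continuous fun r : ℝ => m + r ^ 2 * M := by fun_prop
    simpa using (hc.tendsto 0).mono_left nhdsWithin_le_nhds
  simpa using hrem.add hpoly

end Heisenberg

theorem mainTheorem9 (u : Heisenberg → ℝ) (hu : ContDiff ℝ 3 u) (p : Heisenberg) :
    HasAMVLaplacianAt Heisenberg.ccDist volume u p
      ((1 / 2) * (⨍ q in distBall Heisenberg.ccDist (0, 0, 0) 1, q.1 ^ 2 ∂volume) *
        Heisenberg.kohnLaplacian u p) := by
  refine ⟨?_, Heisenberg.tendsto_amvQuotient (hu.of_le (by norm_num)) p⟩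
  filter_upwards [self_mem_nhdsWithin] with r hr
  obtain ⟨K, hK, hsub⟩ := Heisenberg.distBall_subset_compact p hr
  exact ⟨Heisenberg.volume_distBall_pos p hr, Heisenberg.volume_distBall_lt_top p hr,
    (hu.continuous.continuousOn.integrableOn_compact hK).mono_set hsub⟩
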